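/- **Setting.** For $A\in\mathbb{C}^{m\times d}$ and $k\ge 0$ let $\|A\|_2^{(k)}$ be the largest spectral norm over all $k$-column submatrices of $A$ (if $k>d$, the spectral norm of $A$). For $A,\Phi\in\mathbb{C}^{m\times d}$ put $\varepsilon_A^{(k)}=\|A-\Phi\|_2^{(k)}/\|A\|_2^{(k)}$. A vector is $s$-sparse if it has at most $s$ non-zero components. $A$ satisfies the restricted isometry property with constant (RIC) $\delta_k$ if $(1-\delta_k)\|z\|_2^2\le\|Az\|_2^2\le(1+\delta_k)\|z\|_2^2$ for every $k$-sparse $z\in\mathbb{C}^d$. For a vector $w$, $w_k$ denotes the vector that keeps the $k$ components of $w$ largest in magnitude (ties broken arbitrarily; all components if $k\ge d$) and is zero elsewhere. CoSaMP with measurement matrix $\Phi$, measurement vector $y$ and sparsity level $s$ starts from $a^0=0$ and obtains $a^{k}$ from $a^{k-1}$ ($k\ge1$) as follows: $u=\Phi^*(y-\Phi a^{k-1})$; $T=\operatorname{supp}(u_{2s})\cup\operatorname{supp}(a^{k-1})$; $w|_T=\Phi_T^\dagger y$ and $w|_{T^c}=0$, where $\Phi_T$ consists of the columns of $\Phi$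 indexed by $T$ and $\dagger$ is the Moore–Penrose pseudoinverse; $a^{k}=w_s$. The reconstruction $x^\sharp$ is the approximation $a^k$ at which the iteration is halted. **Corollary 2.3.** There is an absolute constant $C>0$ and, for each $s$, a number of iterations $K(s)$ depending only on $s$, such that the following holds for all $m,d$ and all $A,\Phi\in\mathbb{C}^{m\times d}$. Suppose that $A$ has RIC $$\delta_{4s}\le\frac{1.1}{\bigl(1+\varepsilon_A^{(4s)}\bigr)^2}-1 .$$ Let $x\in\mathbb{C}^d$ be $s$-sparse, $b=Ax$, and $y=b+e=Ax+e$ with $e\in\mathbb{C}^m$ arbitrary. Let $x^\sharp=a^k$ be the reconstruction from CoSaMP run with the decoding matrix $\Phi$ (instead of $A$) on $y$ with sparsity level $s$, halted after any number $k\ge K(s)$ of iterations. Then $$\|x^\sharp-x\|_2\le C\left(\|A-\Phi\|_2^{(s)}\,\|b\|_2+\|e\|_2\right).$$ -/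

import Mathlib

namespace CoSaMP

/-- The support of a vector. -/
noncomputable def supp {d : ℕ} (x : EuclideanSpace ℂ (Fin d)) : Finset (Fin d) :=
  Finset.univ.filter fun i => x i ≠ 0

/-- `x` is `s`-sparse: it has at most `s` non-zero components. -/
def IsSparse {d : ℕ} (s : ℕ) (x : EuclideanSpace ℂ (Fin d)) : Prop :=
  (supp x).card ≤ s

/-- The matrix-vector product, with Euclidean vectors. -/
noncomputable def app {m d : ℕ} (A : Matrix (Fin m) (Fin d) ℂ) (x : EuclideanSpace ℂ (Fin d)) :
    EuclideanSpace ℂ (Fin m) :=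
  WithLp.toLp 2 (A.mulVec x)

/-- The restricted isometry property with parameters `(s, δ)`. -/
def RIP {m d : ℕ} (A : Matrix (Fin m) (Fin d) ℂ) (s : ℕ) (δ : ℝ) : Prop :=
  ∀ x : EuclideanSpace ℂ (Fin d), IsSparse s x →
    (1 - δ) * ‖x‖ ^ 2 ≤ ‖app A x‖ ^ 2 ∧ ‖app A x‖ ^ 2 ≤ (1 + δ) * ‖x‖ ^ 2

open scoped Matrix.Norms.L2Operator in
/-- The spectral norm (largest singular value) of the submatrix `A_T` formed by the columns of `A`
indexed by `T`. -/
noncomputable def columnNorm {m d : ℕ} (A : Matrix (Fin m) (Fin d) ℂ) (T : Finset (Fin d)) : ℝ :=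
  ‖(A.submatrix id (fun i : {i // i ∈ T} => (i : Fin d)))‖

/-- The largest spectral norm over all `k`-column submatrices of `A`. Submatrices with fewer than
`k` columns are admitted too; this does not change the value if `k ≤ d` (deleting columns does not
increase the spectral norm), and if `k > d` it gives the spectral norm of `A`. -/
noncomputable def subNorm {m d : ℕ} (A : Matrix (Fin m) (Fin d) ℂ) (k : ℕ) : ℝ :=
  ⨆ T : {T : Finset (Fin d) // T.card ≤ k}, columnNorm A T

/-- The relative perturbation of the `k`-column submatrices. -/
noncomputable def relPert {m d : ℕ} (A Φ : Matrix (Fin m) (Fin d) ℂ) (k : ℕ) : ℝ :=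
  subNorm (A - Φ) k / subNorm A k

/-- `z` is `w_k`, the vector consisting of the `k` largest components of `w` in magnitude (all of
them if `k ≥ d`), for some way of breaking ties. -/
def IsHead {d : ℕ} (k : ℕ) (w z : EuclideanSpace ℂ (Fin d)) : Prop :=
  ∃ S : Finset (Fin d), S.card = min k d ∧ (∀ i ∈ S, ∀ j ∉ S, ‖w j‖ ≤ ‖w i‖) ∧
    (∀ i ∈ S, z i = w i) ∧ ∀ i ∉ S, z i = 0

/-- `w` is a least-squares solution of `A w ≈ y` among the vectors supported in `T`. -/
def IsLeastSquares {m d : ℕ} (A : Matrix (Fin m) (Fin d) ℂ) (y : EuclideanSpace ℂ (Fin m))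
    (T : Finset (Fin d)) (w : EuclideanSpace ℂ (Fin d)) : Prop :=
  supp w ⊆ T ∧ ∀ z : EuclideanSpace ℂ (Fin d), supp z ⊆ T → ‖y - app A w‖ ≤ ‖y - app A z‖

/-- `w|_T = A_T^† y` and `w|_{T^c} = 0`, where `A_T^†` is the Moore-Penrose pseudoinverse:
`w` is the least-squares solution of smallest norm. -/
def IsPinvSolution {m d : ℕ} (A : Matrix (Fin m) (Fin d) ℂ) (y : EuclideanSpace ℂ (Fin m))
    (T : Finset (Fin d)) (w : EuclideanSpace ℂ (Fin d)) : Prop :=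
  IsLeastSquares A y T w ∧ ∀ z, IsLeastSquares A y T z → ‖w‖ ≤ ‖z‖

/-- One iteration of CoSaMP with measurement matrix `A`, measurement vector `y` and sparsity level
`s`, from the approximation `a` to the approximation `a'`: with `v = y - A a`, form the proxy
`u = A^* v`, merge the support of `u_{2s}` with that of `a`, estimate by least squares on the
merged support, and prune to the `s` largest components. -/
def IsStep {m d : ℕ} (A : Matrix (Fin m) (Fin d) ℂ) (y : EuclideanSpace ℂ (Fin m)) (s : ℕ)
    (a a' : EuclideanSpace ℂ (Fin d)) : Prop :=
  ∃ u₂ w : EuclideanSpace ℂ (Fin d),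
    IsHead (2 * s) (app A.conjTranspose (y - app A a)) u₂ ∧
    IsPinvSolution A y (supp u₂ ∪ supp a) w ∧
    IsHead s w a'

/-- `a` is the sequence of approximations `a⁰, a¹, a², …` of a run of CoSaMP with measurement
matrix `A`, measurement vector `y` and sparsity level `s` (ties being broken arbitrarily). -/
def IsRun {m d : ℕ} (A : Matrix (Fin m) (Fin d) ℂ) (y : EuclideanSpace ℂ (Fin m)) (s : ℕ)
    (a : ℕ → EuclideanSpace ℂ (Fin d)) : Prop :=
  a 0 = 0 ∧ ∀ k, IsStep A y s (a k) (a (k + 1))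


/-- There is always a choice of the `k` largest components. -/
theorem exists_isHead {d : ℕ} (k : ℕ) (w : EuclideanSpace ℂ (Fin d)) : ∃ z, IsHead k w z := by
  suffices h : ∀ n ≤ d, ∃ S : Finset (Fin d), S.card = n ∧ ∀ i ∈ S, ∀ j ∉ S, ‖w j‖ ≤ ‖w i‖ by
    obtain ⟨S, hS, hw⟩ := h (min k d) (min_le_right _ _)
    refine ⟨WithLp.toLp 2 fun i => if i ∈ S then w i else 0, S, hS, hw, ?_, ?_⟩
    · intro i hi
      simp [hi]
    · intro i hi
      simp [hi]
  intro n
  induction n with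
  | zero => exact fun _ => ⟨∅, by simp, by simp⟩
  | succ n ih =>
    intro hn
    obtain ⟨S, hS, hw⟩ := ih (by omega)
    have hne : (Sᶜ : Finset (Fin d)).Nonempty := by
      rw [← Finset.card_pos, Finset.card_compl, Fintype.card_fin]
      omega
    obtain ⟨p, hp, hmax⟩ := Finset.exists_max_image Sᶜ (fun j => ‖w j‖) hne
    rw [Finset.mem_compl] at hp
    refine ⟨insert p S, by rw [Finset.card_insert_of_notMem hp, hS], ?_⟩
    intro i hi j hj
    rw [Finset.mem_insert, not_or] at hj
    rcases Finset.mem_insert.1 hi with rfl | hi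
    · exact hmax j (Finset.mem_compl.2 hj.2)
    · exact hw i hi j hj.2

/-- The vector `A_T^† y`, extended by zero, exists. -/
theorem exists_isPinvSolution {m d : ℕ} (A : Matrix (Fin m) (Fin d) ℂ)
    (y : EuclideanSpace ℂ (Fin m)) (T : Finset (Fin d)) : ∃ w, IsPinvSolution A y T w := by
  let V : Submodule ℂ (EuclideanSpace ℂ (Fin d)) :=
    { carrier := {z | ∀ i ∉ T, z i = 0}
      add_mem' := fun ha hb i hi => by simp [ha i hi, hb i hi]
      zero_mem' := fun i _ => by simp
      smul_mem' := fun c z hz i hi => by simp [hz i hi] }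
  have hV : ∀ z, z ∈ V ↔ supp z ⊆ T := fun z => by
    constructor
    · intro h i hi
      by_contra hc
      exact (Finset.mem_filter.1 hi).2 (h i hc)
    · intro h i hi
      by_contra hc
      exact hi (h (Finset.mem_filter.2 ⟨Finset.mem_univ _, hc⟩))
  have happ : ∀ z, app A z = Matrix.toEuclideanLin A z := fun z => rfl
  have hcont : Continuous (app A) :=
    (Matrix.toEuclideanLin A).continuous_of_finiteDimensional
  let R : Submodule ℂ (EuclideanSpace ℂ (Fin m)) := V.map (Matrix.toEuclideanLin A)
  obtain ⟨_, ⟨w₀, hw₀, rfl⟩, hdist⟩ :=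
    (Submodule.closed_of_finiteDimensional R).exists_infDist_eq_dist ⟨0, R.zero_mem⟩ y
  have hls : IsLeastSquares A y T w₀ := by
    refine ⟨(hV w₀).1 hw₀, fun z hz => ?_⟩
    have := Metric.infDist_le_dist_of_mem (x := y)
      (show Matrix.toEuclideanLin A z ∈ (R : Set _) from ⟨z, (hV z).2 hz, rfl⟩)
    rw [hdist, dist_eq_norm, dist_eq_norm] at this
    exact this
  have hclosed : IsClosed {z | IsLeastSquares A y T z} := by
    have : {z | IsLeastSquares A y T z} =
        (V : Set _) ∩ {z | ‖y - app A z‖ ≤ ‖y - app A w₀‖} := by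
      ext z
      constructor
      · exact fun h => ⟨(hV z).2 h.1, h.2 w₀ hls.1⟩
      · exact fun h => ⟨(hV z).1 h.1, fun z' hz' => le_trans h.2 (hls.2 z' hz')⟩
    rw [this]
    exact (Submodule.closed_of_finiteDimensional V).inter
      (isClosed_le (continuous_const.sub hcont).norm continuous_const)
  obtain ⟨w, hw, hd⟩ := hclosed.exists_infDist_eq_dist ⟨w₀, hls⟩ 0
  refine ⟨w, hw, fun z hz => ?_⟩
  have := Metric.infDist_le_dist_of_mem (x := (0 : EuclideanSpace ℂ (Fin d)))
    (show z ∈ {z | IsLeastSquares A y T z} from hz)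
  rw [hd, dist_zero_left, dist_zero_left] at this
  exact this

/-- CoSaMP can always be run. -/
theorem exists_isRun {m d : ℕ} (A : Matrix (Fin m) (Fin d) ℂ) (y : EuclideanSpace ℂ (Fin m))
    (s : ℕ) : ∃ a, IsRun A y s a := by
  have hstep : ∀ a, ∃ a', IsStep A y s a a' := fun a => by
    obtain ⟨u₂, hu⟩ := exists_isHead (2 * s) (app A.conjTranspose (y - app A a))
    obtain ⟨w, hw⟩ := exists_isPinvSolution A y (supp u₂ ∪ supp a)
    obtain ⟨a', ha'⟩ := exists_isHead s w
    exact ⟨a', u₂, w, hu, hw, ha'⟩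
  choose f hf using hstep
  exact ⟨fun k => Nat.rec 0 (fun _ a => f a) k, rfl, fun k => hf _⟩

end CoSaMP

/-!
If `A` has a small restricted isometry constant and `Φ` is close to `A`, then `Φ` has restricted
isometry constant `0.1` on `4s`-sparse vectors, and `y = Φ x + e'` with the noise
`e' = (A - Φ) x + e`. So it suffices to analyse CoSaMP for a matrix `Φ` with `δ₄ₛ ≤ 0.1`.

On a small set `T` of components the proxy `Φ* (Φ r + e)` is a perturbation of `r`, because
`P_T Φ* Φ P_T` is close to the coordinate projection `P_T`. Hence the merged support of an
iteration carries most of the energy of `x`, and the energy `M k` of `x` outside the merged support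
of iteration `k` is halved in each step until it is of the order of `‖e'‖`. To bound the number of
steps independently of `x`, note that `M k` is, up to a factor `√s`, one of the at most `s` numbers
`|x i|`; as `s` halvings beat this factor, two iterations that are at least `s` apart use different
numbers, and the halving stops after `s ^ 2` steps.
-/

namespace CoSaMP

section Dominating

variable {ι : Type*} [DecidableEq ι] {S X : Finset ι}

theorem sum_sdiff_le_sum_sdiff_of_dominating {f : ι → ℝ} (hf : ∀ i, 0 ≤ f i)
    (hS : ∀ i ∈ S, ∀ j ∉ S, f j ≤ f i) (hX : X.card ≤ S.card) :
    ∑ i ∈ X \ S, f i ≤ ∑ i ∈ S \ X, f i := by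
  rcases (X \ S).eq_empty_or_nonempty with hempty | hne
  · rw [hempty, Finset.sum_empty]
    exact Finset.sum_nonneg fun i _ => hf i
  obtain ⟨p, hp, hmax⟩ := Finset.exists_max_image (X \ S) f hne
  calc ∑ i ∈ X \ S, f i ≤ (X \ S).card • f p := Finset.sum_le_card_nsmul _ _ _ hmax
    _ ≤ (S \ X).card • f p :=
        nsmul_le_nsmul_left (hf p) (Finset.card_sdiff_le_card_sdiff_iff.2 hX)
    _ ≤ ∑ i ∈ S \ X, f i := Finset.card_nsmul_le_sum _ _ _ fun i hi =>
        hS i (Finset.mem_sdiff.1 hi).1 p (Finset.mem_sdiff.1 hp).2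

end Dominating

section Restr

variable {𝕜 ι : Type*} [RCLike 𝕜] [Fintype ι] [DecidableEq ι]

/-- The coordinate projection `P_T`, which keeps the components in `T` and sets the others to
zero. It acts on the whole space, so that `Φ ∘ P_T` stands for the column submatrix `Φ_T`. -/
noncomputable def restr (T : Finset ι) : EuclideanSpace 𝕜 ι →L[𝕜] EuclideanSpace 𝕜 ι :=
  LinearMap.toContinuousLinearMap
    { toFun := fun x => WithLp.toLp 2 fun i => if i ∈ T then x i else 0
      map_add' := fun x y => by ext i; by_cases hi : i ∈ T <;> simp [hi]
      map_smul' := fun c x => by ext i; by_cases hi : i ∈ T <;> simp [hi] }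

@[simp]
theorem restr_apply (T : Finset ι) (x : EuclideanSpace 𝕜 ι) (i : ι) :
    restr T x i = if i ∈ T then x i else 0 := rfl

theorem isSelfAdjoint_restr (T : Finset ι) : IsSelfAdjoint (restr (𝕜 := 𝕜) T) := by
  refine ContinuousLinearMap.isSelfAdjoint_iff_isSymmetric.2 fun x y => ?_
  simp only [ContinuousLinearMap.coe_coe, PiLp.inner_apply, restr_apply]
  refine Finset.sum_congr rfl fun i _ => ?_
  split_ifs <;> simp

theorem restr_restr (S T : Finset ι) (x : EuclideanSpace 𝕜 ι) :
    restr S (restr T x) = restr (S ∩ T) x := by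
  ext i
  by_cases hS : i ∈ S <;> simp [hS]

theorem restr_add_restr_compl (T : Finset ι) (x : EuclideanSpace 𝕜 ι) :
    restr T x + restr Tᶜ x = x := by
  ext i
  by_cases hi : i ∈ T <;> simp [hi]

theorem norm_restr_sq (T : Finset ι) (x : EuclideanSpace 𝕜 ι) :
    ‖restr T x‖ ^ 2 = ∑ i ∈ T, ‖x i‖ ^ 2 := by
  simp [EuclideanSpace.norm_sq_eq, apply_ite, Finset.sum_ite_mem]

theorem norm_restr_mono {S T : Finset ι} (hST : S ⊆ T) (x : EuclideanSpace 𝕜 ι) :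
    ‖restr S x‖ ≤ ‖restr T x‖ := by
  refine le_of_sq_le_sq ?_ (norm_nonneg _)
  rw [norm_restr_sq, norm_restr_sq]
  exact Finset.sum_le_sum_of_subset_of_nonneg hST fun i _ _ => sq_nonneg _

theorem norm_restr_le (T : Finset ι) (x : EuclideanSpace 𝕜 ι) : ‖restr T x‖ ≤ ‖x‖ := by
  refine le_of_sq_le_sq ?_ (norm_nonneg _)
  rw [norm_restr_sq, EuclideanSpace.norm_sq_eq]
  exact Finset.sum_le_univ_sum_of_nonneg fun i => sq_nonneg _

variable {S X : Finset ι} {w : EuclideanSpace 𝕜 ι}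

theorem norm_restr_sdiff_le_of_dominating (hS : ∀ i ∈ S, ∀ j ∉ S, ‖w j‖ ≤ ‖w i‖)
    (hX : X.card ≤ S.card) : ‖restr (X \ S) w‖ ≤ ‖restr (S \ X) w‖ := by
  refine le_of_sq_le_sq ?_ (norm_nonneg _)
  rw [norm_restr_sq, norm_restr_sq]
  exact sum_sdiff_le_sum_sdiff_of_dominating (fun i => sq_nonneg _)
    (fun i hi j hj => pow_le_pow_left₀ (norm_nonneg _) (hS i hi j hj) 2) hX

theorem norm_restr_compl_le_of_dominating (hS : ∀ i ∈ S, ∀ j ∉ S, ‖w j‖ ≤ ‖w i‖)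
    (hX : X.card ≤ S.card) : ‖restr Sᶜ w‖ ≤ ‖restr Xᶜ w‖ := by
  refine le_of_sq_le_sq ?_ (norm_nonneg _)
  rw [norm_restr_sq, norm_restr_sq, ← Finset.sum_sdiff_le_sum_sdiff, compl_sdiff_compl,
    compl_sdiff_compl, ← norm_restr_sq, ← norm_restr_sq]
  exact pow_le_pow_left₀ (norm_nonneg _) (norm_restr_sdiff_le_of_dominating hS hX) 2

end Restr

variable {m d : ℕ}

section Support

variable {x y : EuclideanSpace ℂ (Fin d)} {T : Finset (Fin d)}

@[simp]
theorem mem_supp {i : Fin d} : i ∈ supp x ↔ x i ≠ 0 := by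
  simp [supp]

theorem supp_subset_iff : supp x ⊆ T ↔ ∀ i ∉ T, x i = 0 := by
  simp only [Finset.subset_iff, mem_supp, not_imp_comm]

theorem supp_restr (T : Finset (Fin d)) (x : EuclideanSpace ℂ (Fin d)) :
    supp (restr T x) = T ∩ supp x := by
  ext i
  simp

theorem restr_eq_self (hx : supp x ⊆ T) : restr T x = x := by
  ext i
  by_cases hi : i ∈ T <;> simp [hi, supp_subset_iff.1 hx]

theorem supp_sub_subset_union (x y : EuclideanSpace ℂ (Fin d)) :
    supp (x - y) ⊆ supp x ∪ supp y :=
  supp_subset_iff.2 fun i hi => by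
    simp only [Finset.mem_union, mem_supp, not_or, not_not] at hi
    simp [hi]

theorem isSparse_of_supp_subset {k : ℕ} (hx : supp x ⊆ T) (hT : T.card ≤ k) : IsSparse k x :=
  (Finset.card_le_card hx).trans hT

theorem isSparse_restr {k : ℕ} (hT : T.card ≤ k) (x : EuclideanSpace ℂ (Fin d)) :
    IsSparse k (restr T x) :=
  isSparse_of_supp_subset ((supp_restr T x).trans_subset Finset.inter_subset_left) hT

theorem IsSparse.sub {j k : ℕ} (hx : IsSparse j x) (hy : IsSparse k y) :
    IsSparse (j + k) (x - y) :=
  isSparse_of_supp_subset (supp_sub_subset_union x y)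
    ((Finset.card_union_le _ _).trans (add_le_add hx hy))

theorem exists_norm_le_sqrt_card_supp_mul (hx : x ≠ 0) :
    ∃ i ∈ supp x, ‖x‖ ≤ √(supp x).card * ‖x i‖ := by
  have hne : (supp x).Nonempty := by
    rw [Finset.nonempty_iff_ne_empty]
    intro hempty
    refine hx (PiLp.ext fun i => supp_subset_iff.1 hempty.subset i (Finset.notMem_empty i))
  obtain ⟨p, hp, hmax⟩ := Finset.exists_max_image (supp x) (fun i => ‖x i‖) hne
  refine ⟨p, hp, le_of_sq_le_sq ?_ (by positivity)⟩
  calc ‖x‖ ^ 2 = ∑ i ∈ supp x, ‖x i‖ ^ 2 := by rw [← norm_restr_sq, restr_eq_self subset_rfl]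
    _ ≤ (supp x).card • ‖x p‖ ^ 2 := Finset.sum_le_card_nsmul _ _ _ fun i hi =>
        pow_le_pow_left₀ (norm_nonneg _) (hmax i hi) 2
    _ = (√(supp x).card * ‖x p‖) ^ 2 := by
        rw [mul_pow, Real.sq_sqrt (Nat.cast_nonneg _), nsmul_eq_mul]

theorem exists_norm_restr_comparable {s : ℕ} (hx : IsSparse s x) (hT : restr T x ≠ 0) :
    ∃ i ∈ supp x, ‖x i‖ ≤ ‖restr T x‖ ∧ ‖restr T x‖ ≤ √s * ‖x i‖ := by
  obtain ⟨i, hi, hle⟩ := exists_norm_le_sqrt_card_supp_mul hT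
  rw [supp_restr, Finset.mem_inter] at hi
  have hxi : restr T x i = x i := by simp [hi.1]
  rw [hxi] at hle
  refine ⟨i, hi.2, hxi ▸ PiLp.norm_apply_le _ i, hle.trans ?_⟩
  gcongr
  exact (Finset.card_le_card ((supp_restr T x).trans_subset Finset.inter_subset_right)).trans hx

end Support

section Head

variable {k : ℕ} {w z : EuclideanSpace ℂ (Fin d)}

theorem IsHead.exists_restr (hz : IsHead k w z) :
    ∃ S : Finset (Fin d), S.card = min k d ∧ (∀ i ∈ S, ∀ j ∉ S, ‖w j‖ ≤ ‖w i‖) ∧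
      z = restr S w := by
  obtain ⟨S, hcard, hS, hin, hout⟩ := hz
  refine ⟨S, hcard, hS, PiLp.ext fun i => ?_⟩
  by_cases hi : i ∈ S
  · simp [hi, hin i hi]
  · simp [hi, hout i hi]

theorem IsHead.isSparse (hz : IsHead k w z) : IsSparse k z := by
  obtain ⟨S, hcard, -, rfl⟩ := hz.exists_restr
  exact isSparse_restr (hcard.trans_le (min_le_left _ _)) w

theorem card_le_min_of_card_le {X : Finset (Fin d)} (hX : X.card ≤ k) : X.card ≤ min k d :=
  le_min hX (card_finset_fin_le X)

theorem IsHead.norm_sub_le (hz : IsHead k w z) {x : EuclideanSpace ℂ (Fin d)}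
    (hx : IsSparse k x) : ‖w - z‖ ≤ ‖w - x‖ := by
  obtain ⟨S, hcard, hS, rfl⟩ := hz.exists_restr
  have htail : restr (supp x)ᶜ (w - x) = restr (supp x)ᶜ w := by
    ext i
    by_cases hi : x i = 0 <;> simp [hi]
  calc ‖w - restr S w‖ = ‖restr Sᶜ w‖ := by rw [sub_eq_of_eq_add' (restr_add_restr_compl S w).symm]
    _ ≤ ‖restr (supp x)ᶜ w‖ :=
        norm_restr_compl_le_of_dominating hS ((card_le_min_of_card_le hx).trans hcard.ge)
    _ = ‖restr (supp x)ᶜ (w - x)‖ := by rw [htail]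
    _ ≤ ‖w - x‖ := norm_restr_le _ _

theorem IsHead.norm_restr_sdiff_le (hz : IsHead k w z) {X : Finset (Fin d)} (hX : X.card ≤ k) :
    ‖restr (X \ supp z) w‖ ≤ ‖restr (supp z \ X) w‖ := by
  obtain ⟨S, hcard, hS, rfl⟩ := hz.exists_restr
  have hleft : restr (X \ supp (restr S w)) w = restr (X \ S) w := by
    ext i
    by_cases hi : w i = 0 <;> simp [hi]
  have hright : restr (supp (restr S w) \ X) w = restr (S \ X) w := by
    ext i
    by_cases hi : w i = 0 <;> simp [hi]
  rw [hleft, hright]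
  exact norm_restr_sdiff_le_of_dominating hS ((card_le_min_of_card_le hX).trans hcard.ge)

end Head

section Operator

/-- The matrix `A` as a continuous linear map between Euclidean spaces. -/
noncomputable def appL (A : Matrix (Fin m) (Fin d) ℂ) :
    EuclideanSpace ℂ (Fin d) →L[ℂ] EuclideanSpace ℂ (Fin m) :=
  LinearMap.toContinuousLinearMap (Matrix.toEuclideanLin A)

/-- The operator `A ∘ P_T`, which stands for the submatrix `A_T` of the columns of `A` indexed by
`T`, but is defined on vectors of full length. -/
noncomputable def columnOp (A : Matrix (Fin m) (Fin d) ℂ) (T : Finset (Fin d)) :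
    EuclideanSpace ℂ (Fin d) →L[ℂ] EuclideanSpace ℂ (Fin m) :=
  appL A ∘L restr T

variable (A B : Matrix (Fin m) (Fin d) ℂ) (T : Finset (Fin d))

theorem app_zero : app A 0 = 0 := map_zero (appL A)

theorem app_add (x y : EuclideanSpace ℂ (Fin d)) : app A (x + y) = app A x + app A y :=
  map_add (appL A) x y

theorem app_sub (x y : EuclideanSpace ℂ (Fin d)) : app A (x - y) = app A x - app A y :=
  map_sub (appL A) x y

theorem sub_app (x : EuclideanSpace ℂ (Fin d)) : app (A - B) x = app A x - app B x := by
  simp [app, Matrix.sub_mulVec]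

theorem columnOp_apply (x : EuclideanSpace ℂ (Fin d)) : columnOp A T x = app A (restr T x) := rfl

theorem adjoint_appL : ContinuousLinearMap.adjoint (appL A) = appL A.conjTranspose := by
  rw [appL, appL, Matrix.toEuclideanLin_conjTranspose_eq_adjoint]
  rfl

theorem adjoint_columnOp_apply (y : EuclideanSpace ℂ (Fin m)) :
    ContinuousLinearMap.adjoint (columnOp A T) y = restr T (app A.conjTranspose y) := by
  rw [columnOp, ContinuousLinearMap.adjoint_comp, (isSelfAdjoint_restr T).adjoint_eq, adjoint_appL]
  rfl

open scoped Matrix.Norms.L2Operator in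
theorem columnNorm_eq_norm_columnOp : columnNorm A T = ‖columnOp A T‖ := by
  let D : Matrix (Fin d) (Fin d) ℂ := Matrix.diagonal fun i => if i ∈ T then 1 else 0
  let AT := A.submatrix id (fun i : {i // i ∈ T} => (i : Fin d))
  have hAD (j : Fin m) (i : Fin d) : (A * D) j i = if i ∈ T then A j i else 0 := by
    simp only [D, Matrix.mul_diagonal, mul_ite, mul_one, mul_zero]
  have hgram : AT * AT.conjTranspose = (A * D) * (A * D).conjTranspose := by
    ext j l
    rw [Matrix.mul_apply, Matrix.mul_apply]
    simp only [AT, Matrix.conjTranspose_apply, Matrix.submatrix_apply, hAD, id]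
    rw [Finset.sum_coe_sort T fun i => A j i * star (A l i)]
    simp [apply_ite, Finset.sum_ite_mem]
  have hnorm : ‖AT‖ = ‖A * D‖ := by
    rw [← Matrix.l2_opNorm_conjTranspose AT, ← Matrix.l2_opNorm_conjTranspose (A * D)]
    refine (mul_self_inj (norm_nonneg _) (norm_nonneg _)).1 ?_
    simp only [← Matrix.l2_opNorm_conjTranspose_mul_self, Matrix.conjTranspose_conjTranspose, hgram]
  have hcomp : columnOp A T = appL (A * D) := by
    ext x : 1
    change WithLp.toLp 2 (A.mulVec (restr T x)) = WithLp.toLp 2 ((A * D).mulVec x)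
    rw [← Matrix.mulVec_mulVec]
    congr
    ext i
    simp [D, Matrix.mulVec_diagonal]
  rw [columnNorm, hnorm, hcomp]
  rfl

end Operator

section SubNorm

variable {A : Matrix (Fin m) (Fin d) ℂ} {k : ℕ}

theorem subNorm_nonneg (A : Matrix (Fin m) (Fin d) ℂ) (k : ℕ) : 0 ≤ subNorm A k :=
  Real.iSup_nonneg fun T => (columnNorm_eq_norm_columnOp A T).symm ▸ norm_nonneg _

theorem relPert_nonneg (A B : Matrix (Fin m) (Fin d) ℂ) (k : ℕ) : 0 ≤ relPert A B k :=
  div_nonneg (subNorm_nonneg _ _) (subNorm_nonneg _ _)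

theorem norm_app_le_subNorm (A : Matrix (Fin m) (Fin d) ℂ) {z : EuclideanSpace ℂ (Fin d)}
    (hz : IsSparse k z) : ‖app A z‖ ≤ subNorm A k * ‖z‖ := by
  have hcolumn : columnNorm A (supp z) ≤ subNorm A k :=
    le_ciSup (f := fun T : {T : Finset (Fin d) // T.card ≤ k} => columnNorm A T)
      (Set.finite_range _).bddAbove ⟨supp z, hz⟩
  calc ‖app A z‖ = ‖columnOp A (supp z) z‖ := by rw [columnOp_apply, restr_eq_self subset_rfl]
    _ ≤ columnNorm A (supp z) * ‖z‖ :=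
        columnNorm_eq_norm_columnOp A _ ▸ (columnOp A (supp z)).le_opNorm z
    _ ≤ subNorm A k * ‖z‖ := by gcongr

theorem norm_columnOp_le {T : Finset (Fin d)} (hT : T.card ≤ k) {c : ℝ} (hc : 0 ≤ c)
    (h : ∀ z, IsSparse k z → ‖app A z‖ ≤ c * ‖z‖) : ‖columnOp A T‖ ≤ c :=
  (columnOp A T).opNorm_le_bound hc fun z =>
    (h _ (isSparse_restr hT z)).trans (mul_le_mul_of_nonneg_left (norm_restr_le T z) hc)

theorem subNorm_le {c : ℝ} (hc : 0 ≤ c) (h : ∀ z, IsSparse k z → ‖app A z‖ ≤ c * ‖z‖) :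
    subNorm A k ≤ c :=
  have : Nonempty {T : Finset (Fin d) // T.card ≤ k} := ⟨⟨∅, Nat.zero_le k⟩⟩
  ciSup_le fun T => (columnNorm_eq_norm_columnOp A T).trans_le (norm_columnOp_le T.2 hc h)

end SubNorm

section RIP

variable {A Φ : Matrix (Fin m) (Fin d) ℂ} {k n : ℕ} {δ δ' : ℝ}

theorem RIP.mono (h : RIP A n δ) (hk : k ≤ n) (hδ : δ ≤ δ') : RIP A k δ' := by
  intro x hx
  obtain ⟨hlow, hup⟩ := h x (hx.trans hk)
  constructor
  · exact hlow.trans' (by gcongr)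
  · exact hup.trans (by gcongr)

theorem RIP.norm_app_le (h : RIP A k δ) {z : EuclideanSpace ℂ (Fin d)} (hz : IsSparse k z) :
    ‖app A z‖ ≤ √(1 + δ) * ‖z‖ := by
  rw [← Real.sqrt_sq (norm_nonneg z), ← Real.sqrt_mul' _ (sq_nonneg _)]
  exact Real.le_sqrt_of_sq_le (h z hz).2

theorem RIP.sqrt_mul_norm_le (h : RIP A k δ) {z : EuclideanSpace ℂ (Fin d)} (hz : IsSparse k z) :
    √(1 - δ) * ‖z‖ ≤ ‖app A z‖ := by
  rw [← Real.sqrt_sq (norm_nonneg z), ← Real.sqrt_mul' _ (sq_nonneg _)]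
  exact Real.sqrt_le_iff.2 ⟨norm_nonneg _, (h z hz).1⟩

theorem RIP.subNorm_le (h : RIP A k δ) : subNorm A k ≤ √(1 + δ) :=
  CoSaMP.subNorm_le (Real.sqrt_nonneg _) fun _ hz => h.norm_app_le hz

theorem RIP.subNorm_pos (h : RIP A k δ) (hδ : δ < 1) {z : EuclideanSpace ℂ (Fin d)}
    (hz : IsSparse k z) (hne : z ≠ 0) : 0 < subNorm A k := by
  have hz0 : 0 < ‖z‖ := norm_pos_iff.2 hne
  have hpos : 0 < √(1 - δ) * ‖z‖ := mul_pos (Real.sqrt_pos.2 (sub_pos.2 hδ)) hz0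
  exact pos_of_mul_pos_left
    (hpos.trans_le ((h.sqrt_mul_norm_le hz).trans (norm_app_le_subNorm A hz))) hz0.le

theorem RIP.norm_app_sub_le (h : RIP A k δ) (hδ : δ < 1) {z : EuclideanSpace ℂ (Fin d)}
    (hz : IsSparse k z) : ‖app A z - app Φ z‖ ≤ relPert A Φ k * √(1 + δ) * ‖z‖ := by
  rcases eq_or_ne z 0 with rfl | hne
  · simp [app_zero]
  calc ‖app A z - app Φ z‖ ≤ subNorm (A - Φ) k * ‖z‖ :=
        sub_app A Φ z ▸ norm_app_le_subNorm (A - Φ) hz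
    _ = relPert A Φ k * subNorm A k * ‖z‖ := by
        rw [relPert, div_mul_cancel₀ _ (h.subNorm_pos hδ hz hne).ne']
    _ ≤ relPert A Φ k * √(1 + δ) * ‖z‖ := by
        gcongr
        · exact relPert_nonneg A Φ k
        · exact h.subNorm_le

theorem abs_norm_sq_sub_norm_sq_le {E : Type*} [SeminormedAddCommGroup E] (u v : E) :
    |‖u‖ ^ 2 - ‖v‖ ^ 2| ≤ ‖u - v‖ * (2 * ‖u‖ + ‖u - v‖) := by
  have hv : ‖u‖ + ‖v‖ ≤ 2 * ‖u‖ + ‖u - v‖ := by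
    linarith [norm_le_insert' v u, norm_sub_rev u v]
  calc |‖u‖ ^ 2 - ‖v‖ ^ 2| = |‖u‖ - ‖v‖| * (‖u‖ + ‖v‖) := by
        rw [sq_sub_sq, abs_mul, abs_of_nonneg (by positivity : 0 ≤ ‖u‖ + ‖v‖), mul_comm]
    _ ≤ ‖u - v‖ * (2 * ‖u‖ + ‖u - v‖) := by
        gcongr
        exact abs_norm_sub_norm_le u v

theorem RIP.perturb (h : RIP A k δ) (hδ : δ < 1) :
    RIP Φ k ((1 + δ) * (1 + relPert A Φ k) ^ 2 - 1) := by
  intro z hz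
  rcases eq_or_ne z 0 with rfl | hne
  · simp [app_zero]
  obtain ⟨hlow, hup⟩ := h z hz
  have hδ0 : 0 ≤ 1 + δ :=
    nonneg_of_mul_nonneg_left ((sq_nonneg _).trans hup) (by positivity)
  have hε := relPert_nonneg A Φ k
  set ε := relPert A Φ k
  have hsq : |‖app A z‖ ^ 2 - ‖app Φ z‖ ^ 2| ≤ (1 + δ) * ((1 + ε) ^ 2 - 1) * ‖z‖ ^ 2 :=
    calc |‖app A z‖ ^ 2 - ‖app Φ z‖ ^ 2|
        ≤ ‖app A z - app Φ z‖ * (2 * ‖app A z‖ + ‖app A z - app Φ z‖) :=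
          abs_norm_sq_sub_norm_sq_le _ _
      _ ≤ (ε * √(1 + δ) * ‖z‖) * (2 * (√(1 + δ) * ‖z‖) + ε * √(1 + δ) * ‖z‖) := by
          gcongr
          · exact h.norm_app_sub_le hδ hz
          · exact h.norm_app_le hz
          · exact h.norm_app_sub_le hδ hz
      _ = √(1 + δ) ^ 2 * ((1 + ε) ^ 2 - 1) * ‖z‖ ^ 2 := by ring
      _ = (1 + δ) * ((1 + ε) ^ 2 - 1) * ‖z‖ ^ 2 := by rw [Real.sq_sqrt hδ0]
  rw [abs_le] at hsq
  constructor <;> linarith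

theorem le_sub_one_of_le_div_relPert {c : ℝ} (hc : 0 ≤ c)
    (hδ : δ ≤ c / (1 + relPert A Φ k) ^ 2 - 1) : δ ≤ c - 1 :=
  hδ.trans (sub_le_sub_right (div_le_self hc
    (one_le_pow₀ (le_add_of_nonneg_right (relPert_nonneg A Φ k)))) 1)

theorem RIP.perturb_of_le_div_relPert (h : RIP A k δ) (hδ1 : δ < 1) {c : ℝ}
    (hδ : δ ≤ c / (1 + relPert A Φ k) ^ 2 - 1) : RIP Φ k (c - 1) := by
  have hε := relPert_nonneg A Φ k
  refine (h.perturb hδ1).mono le_rfl (sub_le_sub_right ?_ 1)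
  exact (le_div_iff₀ (by positivity)).1 (by linarith)

end RIP

section NearIsometry

variable {Φ : Matrix (Fin m) (Fin d) ℂ} {n : ℕ} {δ : ℝ} {T : Finset (Fin d)}

theorem RIP.norm_columnOp_le (h : RIP Φ n δ) (hT : T.card ≤ n) : ‖columnOp Φ T‖ ≤ √(1 + δ) :=
  CoSaMP.norm_columnOp_le hT (Real.sqrt_nonneg _) fun _ hz => h.norm_app_le hz

theorem RIP.norm_restr_app_conjTranspose_le (h : RIP Φ n δ) (hT : T.card ≤ n)
    (y : EuclideanSpace ℂ (Fin m)) : ‖restr T (app Φ.conjTranspose y)‖ ≤ √(1 + δ) * ‖y‖ := by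
  rw [← adjoint_columnOp_apply]
  refine (ContinuousLinearMap.adjoint (columnOp Φ T)).le_of_opNorm_le ?_ y
  rw [LinearIsometryEquiv.norm_map]
  exact h.norm_columnOp_le hT

theorem norm_le_of_forall_abs_reApplyInnerSelf_le {𝕜 E : Type*} [RCLike 𝕜]
    [NormedAddCommGroup E] [InnerProductSpace 𝕜 E] {G : E →L[𝕜] E} (hG : G.IsSymmetric) {c : ℝ}
    (hc : 0 ≤ c) (h : ∀ x, |G.reApplyInnerSelf x| ≤ c * ‖x‖ ^ 2) : ‖G‖ ≤ c := by
  rw [ContinuousLinearMap.norm_eq_iSup_rayleighQuotient G hG]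
  refine ciSup_le fun x => ?_
  rw [ContinuousLinearMap.rayleighQuotient, abs_div, abs_of_nonneg (sq_nonneg ‖x‖)]
  exact div_le_of_le_mul₀ (sq_nonneg _) hc (h x)

theorem reApplyInnerSelf_adjoint_comp_columnOp_sub_restr (Φ : Matrix (Fin m) (Fin d) ℂ)
    (T : Finset (Fin d)) (x : EuclideanSpace ℂ (Fin d)) :
    (ContinuousLinearMap.adjoint (columnOp Φ T) ∘L columnOp Φ T - restr T).reApplyInnerSelf x =
      ‖app Φ (restr T x)‖ ^ 2 - ‖restr T x‖ ^ 2 := by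
  have hrestr : ContinuousLinearMap.adjoint (restr T) ∘L restr T = restr (𝕜 := ℂ) T := by
    ext1 z
    rw [(isSelfAdjoint_restr T).adjoint_eq, ContinuousLinearMap.comp_apply, restr_restr,
      Finset.inter_self]
  rw [ContinuousLinearMap.reApplyInnerSelf_apply, sub_apply, inner_sub_left,
    map_sub, ← ContinuousLinearMap.apply_norm_sq_eq_inner_adjoint_left, columnOp_apply]
  nth_rw 2 [← hrestr]
  rw [← ContinuousLinearMap.apply_norm_sq_eq_inner_adjoint_left]

theorem RIP.norm_adjoint_comp_columnOp_sub_restr_le (h : RIP Φ n δ) (hδ : 0 ≤ δ)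
    (hT : T.card ≤ n) :
    ‖ContinuousLinearMap.adjoint (columnOp Φ T) ∘L columnOp Φ T - restr T‖ ≤ δ := by
  refine norm_le_of_forall_abs_reApplyInnerSelf_le ?_ hδ fun x => ?_
  · refine ContinuousLinearMap.isSelfAdjoint_iff_isSymmetric.1 (.sub ?_ (isSelfAdjoint_restr T))
    exact (columnOp Φ T).isPositive_adjoint_comp_self.isSelfAdjoint
  · obtain ⟨hlow, hup⟩ := h (restr T x) (isSparse_restr hT x)
    rw [reApplyInnerSelf_adjoint_comp_columnOp_sub_restr]
    calc |‖app Φ (restr T x)‖ ^ 2 - ‖restr T x‖ ^ 2| ≤ δ * ‖restr T x‖ ^ 2 :=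
          abs_le.2 ⟨by linarith, by linarith⟩
      _ ≤ δ * ‖x‖ ^ 2 := by
          gcongr
          exact norm_restr_le T x

theorem RIP.norm_restr_proxy_sub_le (h : RIP Φ n δ) (hδ : 0 ≤ δ) (hT : T.card ≤ n)
    {r : EuclideanSpace ℂ (Fin d)} (hr : supp r ⊆ T) (e : EuclideanSpace ℂ (Fin m)) :
    ‖restr T (app Φ.conjTranspose (app Φ r + e) - r)‖ ≤ δ * ‖r‖ + √(1 + δ) * ‖e‖ := by
  set G := ContinuousLinearMap.adjoint (columnOp Φ T) ∘L columnOp Φ T - restr T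
  have hG : restr T (app Φ.conjTranspose (app Φ r + e) - r) =
      G r + restr T (app Φ.conjTranspose e) := by
    simp only [G, sub_apply, ContinuousLinearMap.comp_apply, columnOp_apply,
      adjoint_columnOp_apply, restr_eq_self hr, app_add, map_add, map_sub]
    abel
  rw [hG]
  exact norm_add_le_of_le (G.le_of_opNorm_le (h.norm_adjoint_comp_columnOp_sub_restr_le hδ hT) r)
    (h.norm_restr_app_conjTranspose_le hT e)

end NearIsometry

section Iteration

variable {Φ : Matrix (Fin m) (Fin d) ℂ} {k n s : ℕ} {δ : ℝ} {T : Finset (Fin d)}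
  {x w : EuclideanSpace ℂ (Fin d)} {e y : EuclideanSpace ℂ (Fin m)}

theorem RIP.norm_restr_compl_supp_head_le (h : RIP Φ n δ) (hδ : 0 ≤ δ) (hn : 2 * k ≤ n)
    {r u : EuclideanSpace ℂ (Fin d)} (hr : IsSparse k r)
    (hu : IsHead k (app Φ.conjTranspose (app Φ r + e)) u) :
    ‖restr (supp u)ᶜ r‖ ≤ 2 * (δ * ‖r‖ + √(1 + δ) * ‖e‖) := by
  set p := app Φ.conjTranspose (app Φ r + e)
  set R := supp r with hR
  set U := supp u
  have hcard : (R ∪ U).card ≤ n := by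
    have := Finset.card_union_le R U
    have : U.card ≤ k := hu.isSparse
    have : R.card ≤ k := hr
    omega
  have herror (S : Finset (Fin d)) (hS : S ⊆ R ∪ U) :
      ‖restr S (p - r)‖ ≤ δ * ‖r‖ + √(1 + δ) * ‖e‖ :=
    (norm_restr_mono hS _).trans
      (h.norm_restr_proxy_sub_le hδ hcard Finset.subset_union_left e)
  have hmissed : restr Uᶜ r = restr (R \ U) p - restr (R \ U) (p - r) := by
    rw [← map_sub, sub_sub_cancel]
    ext i
    by_cases hi : r i = 0 <;> simp [hR, hi]
  have hspurious : restr (U \ R) p = restr (U \ R) (p - r) := by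
    ext i
    by_cases hi : r i = 0 <;> simp [hR, hi]
  calc ‖restr Uᶜ r‖ ≤ ‖restr (R \ U) p‖ + ‖restr (R \ U) (p - r)‖ := hmissed ▸ norm_sub_le _ _
    _ ≤ ‖restr (U \ R) (p - r)‖ + ‖restr (R \ U) (p - r)‖ := by
        gcongr
        exact (hu.norm_restr_sdiff_le hr).trans_eq (congr_arg norm hspurious)
    _ ≤ 2 * (δ * ‖r‖ + √(1 + δ) * ‖e‖) := by
        linarith [herror (U \ R) (Finset.sdiff_subset.trans Finset.subset_union_right),
          herror (R \ U) (Finset.sdiff_subset.trans Finset.subset_union_left)]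

theorem IsLeastSquares.restr_app_conjTranspose_residual (h : IsLeastSquares Φ y T w) :
    restr T (app Φ.conjTranspose (y - app Φ w)) = 0 := by
  rw [← adjoint_columnOp_apply, ← restr_eq_self h.1, ← columnOp_apply]
  refine ((columnOp Φ T).forall_norm_sub_apply_le_iff_adjoint_apply_sub_eq_zero y w).1 fun z => ?_
  rw [columnOp_apply, columnOp_apply, restr_eq_self h.1]
  exact h.2 _ ((supp_restr T z).trans_subset Finset.inter_subset_left)

theorem RIP.norm_sub_le_of_isLeastSquares (h : RIP Φ n δ) (hδ : 0 ≤ δ)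
    (hn : (T ∪ supp x).card ≤ n) (hw : IsLeastSquares Φ (app Φ x + e) T w) :
    (1 - δ) * ‖x - w‖ ≤ ‖restr Tᶜ x‖ + √(1 + δ) * ‖e‖ := by
  set p := app Φ.conjTranspose (app Φ (x - w) + e) with hp
  have hsupp : supp (x - w) ⊆ T ∪ supp x :=
    (supp_sub_subset_union x w).trans
      (Finset.union_subset Finset.subset_union_right (hw.1.trans Finset.subset_union_left))
  have hp0 : restr T p = 0 := by
    rw [hp, app_sub, sub_add_eq_add_sub]
    exact hw.restr_app_conjTranspose_residual
  have hin : ‖restr T (x - w)‖ ≤ δ * ‖x - w‖ + √(1 + δ) * ‖e‖ :=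
    calc ‖restr T (x - w)‖ = ‖restr T (p - (x - w))‖ := by
          rw [map_sub _ p, hp0, zero_sub, norm_neg]
      _ ≤ ‖restr (T ∪ supp x) (p - (x - w))‖ := norm_restr_mono Finset.subset_union_left _
      _ ≤ δ * ‖x - w‖ + √(1 + δ) * ‖e‖ := h.norm_restr_proxy_sub_le hδ hn hsupp e
  have hout : restr Tᶜ (x - w) = restr Tᶜ x := by
    ext i
    by_cases hi : i ∈ T <;> simp [hi, supp_subset_iff.1 hw.1]
  have hsplit : ‖x - w‖ ≤ ‖restr T (x - w)‖ + ‖restr Tᶜ x‖ :=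
    calc ‖x - w‖ = ‖restr T (x - w) + restr Tᶜ (x - w)‖ := by rw [restr_add_restr_compl]
      _ ≤ ‖restr T (x - w)‖ + ‖restr Tᶜ x‖ := hout ▸ norm_add_le _ _
  linarith

variable {a a' : EuclideanSpace ℂ (Fin d)}

theorem IsStep.isSparse (h : IsStep Φ y s a a') : IsSparse s a' :=
  have ⟨_, _, _, _, hhead⟩ := h
  hhead.isSparse

theorem IsStep.exists_norm_restr_compl_le (hΦ : RIP Φ (4 * s) δ) (hδ : 0 ≤ δ) (hδ1 : δ ≤ 1)
    (hx : IsSparse s x) (ha : IsSparse s a) (h : IsStep Φ (app Φ x + e) s a a') :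
    ∃ T : Finset (Fin d), ‖restr Tᶜ x‖ ≤ 2 * (δ * ‖x - a‖ + √(1 + δ) * ‖e‖) ∧
      (1 - δ) * ‖x - a'‖ ≤ 2 * (‖restr Tᶜ x‖ + √(1 + δ) * ‖e‖) := by
  obtain ⟨u, w, hu, ⟨hw, -⟩, hhead⟩ := h
  rw [add_sub_right_comm, ← app_sub] at hu
  refine ⟨supp u ∪ supp a, ?_, ?_⟩
  · have htail : restr (supp u ∪ supp a)ᶜ x = restr (supp u ∪ supp a)ᶜ (x - a) := by
      ext i
      by_cases hi : a i = 0 <;> simp [hi]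
    calc ‖restr (supp u ∪ supp a)ᶜ x‖ ≤ ‖restr (supp u)ᶜ (x - a)‖ :=
          htail ▸ norm_restr_mono (Finset.compl_subset_compl.2 Finset.subset_union_left) _
      _ ≤ 2 * (δ * ‖x - a‖ + √(1 + δ) * ‖e‖) :=
          hΦ.norm_restr_compl_supp_head_le hδ (by omega) (two_mul s ▸ hx.sub ha) hu
  · have hcard : (supp u ∪ supp a ∪ supp x).card ≤ 4 * s := by
      have := Finset.card_union_le (supp u ∪ supp a) (supp x)
      have := Finset.card_union_le (supp u) (supp a)
      have : (supp u).card ≤ 2 * s := hu.isSparse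
      have : (supp a).card ≤ s := ha
      have : (supp x).card ≤ s := hx
      omega
    have hestimate := hΦ.norm_sub_le_of_isLeastSquares hδ hcard hw
    have hprune : ‖x - a'‖ ≤ 2 * ‖x - w‖ := by
      linarith [norm_sub_le_norm_sub_add_norm_sub x w a', hhead.norm_sub_le hx, norm_sub_rev x w]
    calc (1 - δ) * ‖x - a'‖ ≤ (1 - δ) * (2 * ‖x - w‖) :=
          mul_le_mul_of_nonneg_left hprune (sub_nonneg.2 hδ1)
      _ ≤ 2 * (‖restr (supp u ∪ supp a)ᶜ x‖ + √(1 + δ) * ‖e‖) := by linarith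

end Iteration

section Contraction

variable {M : ℕ → ℝ} {ρ B : ℝ}

theorem le_of_le_of_contraction (hM : ∀ k, M (k + 1) ≤ max (ρ * M k) B) (hρ0 : 0 ≤ ρ)
    (hρ1 : ρ ≤ 1) (hB : 0 ≤ B) {j k : ℕ} (hjk : j ≤ k) (hj : M j ≤ B) : M k ≤ B := by
  induction k, hjk using Nat.le_induction with
  | base => exact hj
  | succ k _ ih =>
    refine (hM k).trans (max_le ?_ le_rfl)
    calc ρ * M k ≤ ρ * B := mul_le_mul_of_nonneg_left ih hρ0
      _ ≤ B := mul_le_of_le_one_left hB hρ1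

theorem le_pow_mul_of_contraction (hM : ∀ k, M (k + 1) ≤ max (ρ * M k) B) (hρ0 : 0 ≤ ρ) {j k : ℕ}
    (hjk : j ≤ k) (hlarge : ∀ i ≤ k, B < M i) : M k ≤ ρ ^ (k - j) * M j := by
  induction k, hjk using Nat.le_induction with
  | base => simp
  | succ k hjk ih =>
    calc M (k + 1) ≤ ρ * M k :=
          (le_max_iff.1 (hM k)).resolve_right (hlarge (k + 1) le_rfl).not_ge
      _ ≤ ρ * (ρ ^ (k - j) * M j) :=
          mul_le_mul_of_nonneg_left (ih fun i hi => hlarge i (hi.trans k.le_succ)) hρ0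
      _ = ρ ^ (k + 1 - j) * M j := by rw [Nat.succ_sub hjk, pow_succ', mul_assoc]

/-- By the pigeonhole principle two of the `#S + 1` times `0, L, 2 L, …, #S * L` would otherwise be
comparable to the same `f i`, although `M` has shrunk by the factor `ρ ^ L` in between. -/
theorem le_of_contraction_of_comparable {ι : Type*} {S : Finset ι} {f : ι → ℝ} {κ : ℝ} {L : ℕ}
    (hM : ∀ k, M (k + 1) ≤ max (ρ * M k) B) (hρ0 : 0 ≤ ρ) (hρ1 : ρ ≤ 1) (hB : 0 ≤ B) (hκ : 0 ≤ κ)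
    (hL : κ * ρ ^ L < 1) (hf : ∀ k, 0 < M k → ∃ i ∈ S, f i ≤ M k ∧ M k ≤ κ * f i) {k : ℕ}
    (hk : S.card * L ≤ k) : M k ≤ B := by
  by_contra! hk_large
  have hlarge (j : ℕ) (hj : j ≤ k) : B < M j := by
    by_contra! hle
    exact hk_large.not_ge (le_of_le_of_contraction hM hρ0 hρ1 hB hj hle)
  have htime (j : Fin (S.card + 1)) : j * L ≤ k :=
    (Nat.mul_le_mul_right L j.is_le).trans hk
  have hpos (j : Fin (S.card + 1)) : 0 < M (j * L) := hB.trans_lt (hlarge _ (htime j))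
  choose i hiS hlow hup using fun j : Fin (S.card + 1) => hf (j * L) (hpos j)
  obtain ⟨j, -, l, -, hjl, hij⟩ := Finset.exists_ne_map_eq_of_card_lt_of_maps_to
    (by simp : S.card < (Finset.univ : Finset (Fin (S.card + 1))).card) fun j _ => hiS j
  wlog hlt : j < l generalizing j l
  · exact this l j hjl.symm hij.symm (lt_of_le_of_ne (not_lt.1 hlt) hjl.symm)
  have hgap : j * L + L ≤ l * L := by
    rw [← Nat.succ_mul]
    exact Nat.mul_le_mul_right L hlt
  refine lt_irrefl (M (l * L)) ?_
  calc M (l * L) ≤ ρ ^ (l * L - j * L) * M (j * L) :=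
        le_pow_mul_of_contraction hM hρ0 (by omega) fun i hi => hlarge i (hi.trans (htime l))
    _ ≤ ρ ^ L * M (j * L) :=
        mul_le_mul_of_nonneg_right (pow_le_pow_of_le_one hρ0 hρ1 (by omega)) (hpos j).le
    _ ≤ ρ ^ L * (κ * f (i l)) := by gcongr; exact hij ▸ hup j
    _ ≤ ρ ^ L * (κ * M (l * L)) := by gcongr; exact hlow l
    _ = κ * ρ ^ L * M (l * L) := by ring
    _ < M (l * L) := mul_lt_of_lt_one_left (hpos l) hL

end Contraction

section Run

variable {Φ : Matrix (Fin m) (Fin d) ℂ} {s : ℕ} {x : EuclideanSpace ℂ (Fin d)}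
  {y e : EuclideanSpace ℂ (Fin m)} {a : ℕ → EuclideanSpace ℂ (Fin d)}

theorem IsRun.isSparse (h : IsRun Φ y s a) : ∀ k, IsSparse s (a k)
  | 0 => by simp [h.1, IsSparse, supp]
  | k + 1 => (h.2 k).isSparse

theorem sqrt_mul_half_pow_lt_one (n : ℕ) : √n * (1 / 2) ^ n < 1 := by
  have hlt : (n : ℝ) < 2 ^ n := mod_cast n.lt_two_pow_self
  rw [one_div, inv_pow, ← div_eq_mul_inv, div_lt_one (by positivity),
    Real.sqrt_lt' (by positivity)]
  calc (n : ℝ) < 2 ^ n := hlt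
    _ ≤ (2 ^ n) ^ 2 := le_self_pow₀ (one_le_pow₀ one_le_two) two_ne_zero

theorem IsRun.exists_supports (hΦ : RIP Φ (4 * s) 0.1) (hx : IsSparse s x)
    (h : IsRun Φ (app Φ x + e) s a) :
    ∃ T : ℕ → Finset (Fin d), ∀ k,
      ‖restr (T k)ᶜ x‖ ≤ 0.2 * ‖x - a k‖ + 2.1 * ‖e‖ ∧
      ‖x - a (k + 1)‖ ≤ 20 / 9 * ‖restr (T k)ᶜ x‖ + 7 / 3 * ‖e‖ := by
  have hsqrt : √(1 + 0.1) * ‖e‖ ≤ 1.05 * ‖e‖ := by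
    gcongr
    exact Real.sqrt_le_iff.2 (by norm_num)
  choose T hT using fun k =>
    (h.2 k).exists_norm_restr_compl_le hΦ (by norm_num) (by norm_num) hx (h.isSparse k)
  exact ⟨T, fun k => ⟨by linarith [(hT k).1], by linarith [(hT k).2]⟩⟩

theorem IsRun.norm_sub_le (hΦ : RIP Φ (4 * s) 0.1) (hx : IsSparse s x)
    (h : IsRun Φ (app Φ x + e) s a) {k : ℕ} (hk : s * s + 1 ≤ k) : ‖a k - x‖ ≤ 56 * ‖e‖ := by
  obtain ⟨T, hT⟩ := h.exists_supports hΦ hx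
  have hcontract (k : ℕ) : ‖restr (T (k + 1))ᶜ x‖ ≤
      max (1 / 2 * ‖restr (T k)ᶜ x‖) (24 * ‖e‖) := by
    rw [le_max_iff]
    by_contra! hgt
    linarith [(hT (k + 1)).1, (hT k).2, norm_nonneg e]
  have hcomparable (k : ℕ) (hpos : 0 < ‖restr (T k)ᶜ x‖) :
      ∃ i ∈ supp x, ‖x i‖ ≤ ‖restr (T k)ᶜ x‖ ∧ ‖restr (T k)ᶜ x‖ ≤ √s * ‖x i‖ :=
    exists_norm_restr_comparable hx (norm_pos_iff.1 hpos)
  obtain ⟨j, rfl⟩ := Nat.exists_eq_add_of_le' (Nat.le_of_add_left_le hk)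
  have htail : ‖restr (T j)ᶜ x‖ ≤ 24 * ‖e‖ :=
    le_of_contraction_of_comparable hcontract (by norm_num) (by norm_num) (by positivity)
      (Real.sqrt_nonneg s) (sqrt_mul_half_pow_lt_one s) hcomparable
      ((Nat.mul_le_mul_right s hx).trans (Nat.le_of_succ_le_succ hk))
  rw [norm_sub_rev]
  linarith [(hT j).2, norm_nonneg e]

theorem IsRun.norm_sub_le_of_mismatch {A : Matrix (Fin m) (Fin d) ℂ} (hA : RIP A s 0.1)
    (hΦ : RIP Φ (4 * s) 0.1) (hx : IsSparse s x) (h : IsRun Φ (app A x + e) s a) {k : ℕ}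
    (hk : s * s + 1 ≤ k) : ‖a k - x‖ ≤ 60 * (subNorm (A - Φ) s * ‖app A x‖ + ‖e‖) := by
  have hy : app A x + e = app Φ x + (app (A - Φ) x + e) := by
    rw [sub_app, ← add_assoc, add_sub_cancel]
  have hnorm : ‖x‖ ≤ 1.07 * ‖app A x‖ := by
    have hsqrt : 0.94 ≤ √(1 - 0.1 : ℝ) := Real.le_sqrt_of_sq_le (by norm_num)
    linarith [mul_le_mul_of_nonneg_right hsqrt (norm_nonneg x), hA.sqrt_mul_norm_le hx,
      norm_nonneg (app A x)]
  have hsub := subNorm_nonneg (A - Φ) s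
  calc ‖a k - x‖ ≤ 56 * ‖app (A - Φ) x + e‖ := (hy ▸ h).norm_sub_le hΦ hx hk
    _ ≤ 56 * (subNorm (A - Φ) s * ‖x‖ + ‖e‖) := by
        gcongr
        exact norm_add_le_of_le (norm_app_le_subNorm _ hx) le_rfl
    _ ≤ 56 * (subNorm (A - Φ) s * (1.07 * ‖app A x‖) + ‖e‖) := by gcongr
    _ ≤ 60 * (subNorm (A - Φ) s * ‖app A x‖ + ‖e‖) := by
        linarith [mul_nonneg hsub (norm_nonneg (app A x)), norm_nonneg e]

end Run

end CoSaMP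

theorem corollary2p3 :
    ∃ C : ℝ, 0 < C ∧ ∀ s : ℕ, ∃ K : ℕ,
      ∀ (m d : ℕ) (A Φ : Matrix (Fin m) (Fin d) ℂ) (δ : ℝ),
        CoSaMP.RIP A (4 * s) δ →
        δ ≤ 1.1 / (1 + CoSaMP.relPert A Φ (4 * s)) ^ 2 - 1 →
        ∀ (x : EuclideanSpace ℂ (Fin d)) (b e y : EuclideanSpace ℂ (Fin m)),
          CoSaMP.IsSparse s x →
          b = CoSaMP.app A x →
          y = b + e →
          ∀ a : ℕ → EuclideanSpace ℂ (Fin d), CoSaMP.IsRun Φ y s a →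
            ∀ k : ℕ, K ≤ k →
              ‖a k - x‖ ≤ C * (CoSaMP.subNorm (A - Φ) s * ‖b‖ + ‖e‖) := by
  refine ⟨60, by norm_num, fun s => ⟨s * s + 1, ?_⟩⟩
  rintro m d A Φ δ hA hδ x _ e _ hx rfl rfl a ha k hk
  have hδ_small : δ ≤ 0.1 :=
    (CoSaMP.le_sub_one_of_le_div_relPert (by norm_num) hδ).trans (by norm_num)
  have hΦ : CoSaMP.RIP Φ (4 * s) 0.1 :=
    (hA.perturb_of_le_div_relPert (by linarith) hδ).mono le_rfl (by norm_num)
  exact ha.norm_sub_le_of_mismatch (hA.mono (by omega) hδ_small) hΦ hx hk
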